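/- Let $S$ be a polynomial ring in finitely many variables over an arbitrary field, and let $M\subseteq S$ be a monomial ideal with minimal monomial generating set $G$. A monomial $m\in G$ is called dominant if there are a variable $x$ and an integer $k>0$ such that $x^k\mid m$ and $x^k\nmid m'$ for all $m'\in G\setminus\{m\}$; otherwise it is nondominant. The ideal $M$ is called 2-semidominant if $G$ contains exactly two nondominant monomials; in that case write $G=\{m_1,\dots,m_q,n_1,n_2\}$ with $n_1,n_2$ the nondominant ones. For $\sigma\subseteq G$ (possibly empty) put $\operatorname{mdeg}[\sigma]=\operatorname{lcm}(\sigma)$, with $\operatorname{mdeg}[\varnothing]=1$. The Scarf simplicial complex $\Delta_M$ consists of all $\sigma\subseteq G$ such that $\operatorname{mdeg}[\tau]\neq\operatorname{mdeg}[\sigma]$ for every $\tau\subseteq G$ with $\tau\ne\sigma$. Fix a total order on $G$. The Scarf complex of $M$ is the complex of free $S$-modules with basis $[\sigma]$, $\sigma\in\Delta_M$, in homological degree $\#\sigma$, and differential $$[l_1,\dots,l_j]\mapsto\sum_{i=1}^{j}(-1)^{i+1}\frac{\operatorname{mdeg}[l_1,\dots,l_j]}{\operatorname{mdeg}[l_1,\dots,\widehat{l_i},\dots,l_j]}\,[l_1,\dots,\widehat{l_i},\dots,l_j]\qquad(l_1<\dots<l_j),$$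 augmented to $S/M$ by $[\varnothing]\mapsto 1$. The ideal $M$ is called Scarf if its Scarf complex is a minimal free resolution of $S/M$ (for any total order on $G$). **Corollary 6.9.** Let $M=(m_1,\dots,m_q,n_1,n_2)$ be 2-semidominant. If no variable appears with the same nonzero exponent in both $n_1$ and $n_2$, then $M$ is Scarf. -/

import Mathlib

open MvPolynomial

noncomputable section

namespace MonomialIdeal

/-! Monomials in the variables `ι` are represented by their exponent vectors `ι →₀ ℕ`: divisibility
is `≤` and the least common multiple is `⊔`. -/

section Dominance

variable {ι : Type*} {K : Type*} [Field K]

/-- An ideal generated by monomials. -/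
def IsMonomialIdeal (M : Ideal (MvPolynomial ι K)) : Prop :=
  ∃ A : Set (ι →₀ ℕ), M = Ideal.span ((fun a => monomial a (1 : K)) '' A)

/-- The minimal generating set of a monomial ideal: the monomials of `M` that are minimal with
respect to divisibility. -/
def minGens (M : Ideal (MvPolynomial ι K)) : Set (ι →₀ ℕ) :=
  {a | Minimal (fun b => monomial b (1 : K) ∈ M) a}

/-- `m` is a dominant monomial of the set `G`: it has a dominant variable `x`, that is, for some
positive `k`, `x ^ k` divides `m` and divides no other element of `G`. -/
def IsDominant (G : Set (ι →₀ ℕ)) (m : ι →₀ ℕ) : Prop :=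
  m ∈ G ∧ ∃ x : ι, ∃ k : ℕ, 0 < k ∧ k ≤ m x ∧ ∀ m' ∈ G, m' ≠ m → ¬ k ≤ m' x

/-- The nondominant elements of `G`. -/
def nondominant (G : Set (ι →₀ ℕ)) : Set (ι →₀ ℕ) :=
  {m | m ∈ G ∧ ¬ IsDominant G m}

/-- A monomial ideal is `p`-semidominant if its minimal generating set contains exactly `p`
nondominant monomials. -/
def IsSemidominant (p : ℕ) (M : Ideal (MvPolynomial ι K)) : Prop :=
  IsMonomialIdeal M ∧ (nondominant (minGens M)).encard = p

end Dominance

section ScarfComplex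

variable {ι : Type*} {κ : Type*} [LinearOrder κ] (g : κ → (ι →₀ ℕ))

/-- The multidegree of a face of the full simplex on the (ordered) family of monomials `g`:
the least common multiple of its vertices. -/
def mdeg (s : Finset κ) : ι →₀ ℕ := s.sup g

/-- The Scarf simplicial complex: the faces (possibly empty) whose multidegree is shared by no other
face of the full simplex. -/
def scarfFaces : Set (Finset κ) :=
  {s | ∀ t : Finset κ, mdeg g t = mdeg g s → t = s}

/-- Facets of Scarf faces are Scarf faces. -/
theorem erase_mem_scarfFaces {s : Finset κ} (hs : s ∈ scarfFaces g) {i : κ} (hi : i ∈ s) :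
    s.erase i ∈ scarfFaces g := by
  intro t ht
  have h1 : insert i t = s := by
    apply hs
    have h2 : mdeg g s = mdeg g (insert i (s.erase i)) := by rw [Finset.insert_erase hi]
    rw [h2]
    simp only [mdeg, Finset.sup_insert] at ht ⊢
    rw [ht]
  by_cases hit : i ∈ t
  · rw [Finset.insert_eq_of_mem hit] at h1
    subst h1
    have h3 := hs _ ht.symm
    rw [h3]
  · rw [← h1, Finset.erase_insert hit]

/-- The Scarf faces with `j` vertices; they index a basis in homological degree `j`. -/
def ScarfFace (j : ℕ) : Type _ := {s : Finset κ // s ∈ scarfFaces g ∧ s.card = j}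

/-- The facet obtained from a Scarf face by deleting the vertex `i`. -/
def ScarfFace.facet {j : ℕ} (s : ScarfFace g (j + 1)) (i : {i // i ∈ s.1}) : ScarfFace g j :=
  ⟨s.1.erase i.1, erase_mem_scarfFaces g s.2.1 i.2, by
    rw [Finset.card_erase_of_mem i.2, s.2.2, Nat.add_sub_cancel]⟩

variable (K : Type*) [Field K]

/-- The coefficient `± mdeg s / mdeg (s \ {i})` of the facet `s \ {i}` in the differential of `s`;
the sign is `-1` to the number of vertices of `s` preceding `i`. -/
def facetCoeff (s : Finset κ) (i : κ) : MvPolynomial ι K :=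
  monomial (mdeg g s - mdeg g (s.erase i)) ((-1 : K) ^ (s.filter (· < i)).card)

/-- The free module of the Scarf complex in homological degree `j`. -/
abbrev ScarfModule (j : ℕ) : Type _ := ScarfFace g j →₀ MvPolynomial ι K

/-- The differential of the Scarf complex, from homological degree `j + 1` to degree `j`. -/
def scarfD (j : ℕ) : ScarfModule g K (j + 1) →ₗ[MvPolynomial ι K] ScarfModule g K j :=
  Finsupp.linearCombination (MvPolynomial ι K) fun s : ScarfFace g (j + 1) =>
    ∑ i : {i // i ∈ s.1}, Finsupp.single (s.facet g i) (facetCoeff g K s.1 i.1)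

variable {K}

/-- The augmentation from homological degree `0` to `S / M`, sending `[∅]` to `1`. -/
def scarfAug (M : Ideal (MvPolynomial ι K)) :
    ScarfModule g K 0 →ₗ[MvPolynomial ι K] MvPolynomial ι K ⧸ M :=
  Finsupp.linearCombination (MvPolynomial ι K) fun _ : ScarfFace g 0 => Ideal.Quotient.mk M 1

/-- The Scarf complex of the family `g` is a minimal free resolution of `S / M`: the augmented
complex `⋯ → F₁ → F₀ → S / M → 0` is exact, and each differential has its image in `𝔪 F`, where
`𝔪` is the ideal generated by the variables. -/
structure IsMinimalScarfResolution (M : Ideal (MvPolynomial ι K)) : Prop where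
  aug_surjective : Function.Surjective (scarfAug g M)
  exact_zero : Function.Exact (scarfD g K 0) (scarfAug g M)
  exact_succ : ∀ j : ℕ, Function.Exact (scarfD g K (j + 1)) (scarfD g K j)
  minimal : ∀ j : ℕ, LinearMap.range (scarfD g K j) ≤
    Ideal.span (Set.range (X : ι → MvPolynomial ι K)) • (⊤ : Submodule _ (ScarfModule g K j))

end ScarfComplex

/-- A monomial ideal `M` is Scarf if the Scarf complex on its minimal generators, in whatever order
they are listed, is a minimal free resolution of `S / M`. -/
def IsScarf {ι : Type*} {K : Type*} [Field K] (M : Ideal (MvPolynomial ι K)) : Prop :=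
  ∀ _ : LinearOrder (minGens M),
    IsMinimalScarfResolution (fun a : minGens M => (a : ι →₀ ℕ)) M

end MonomialIdeal

end

/-! Rescaling each basis element `[σ]` by its multidegree embeds the Scarf complex in the chains of
the full simplex on the generators. In multidegree `b` the image is the chain complex over `K` of
the Scarf faces whose multidegree divides `b`, so exactness reduces to the acyclicity of these
subcomplexes when some generator divides `b` (`isMinimalScarfResolution_of_acyclic`). Minimality is
automatic: deleting a vertex of a Scarf face changes its multidegree.

All faces with multidegree dividing `b` form a full simplex, which is a cone. The non-Scarf faces
can be removed from it by a matching. The multidegree determines the dominant vertices of a face, so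
only faces with the same dominant part `D` can share a multidegree. Let `d` be the lcm of `D`. If
`n₁` or `n₂` divides `d`, toggling it never changes the multidegree. Otherwise the exponent
hypothesis gives `d ⊔ n₁ ≠ d ⊔ n₂`, so at most one of `D ∪ {n₁}`, `D ∪ {n₂}` shares its multidegree
with `D ∪ {n₁, n₂}`, and there are no other coincidences. In every case one vertex depending only on
`D` matches the non-Scarf faces over `D` (`exists_toggle`).

The toggle defines a homotopy `h`, and `id - ∂h - h∂` strictly lowers the number of dominant
vertices of faces outside the Scarf complex (`sub_homotopy_mem_lowFaces`). Iterating this pushes a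
chain bounding a Scarf cycle into the Scarf complex (`exists_simplexBoundary_eq_of_matching`). -/

namespace MonomialIdeal

/-! ### Oriented chains of the full simplex. -/

section SimplexChains

variable {κ : Type*} [LinearOrder κ] (R : Type*) [CommRing R]

/-- The incidence sign of the vertex `i` in the face `s`. -/
noncomputable def faceSign (s : Finset κ) (i : κ) : R := (-1 : R) ^ (s.filter (· < i)).card

theorem faceSign_mul_self (s : Finset κ) (i : κ) : faceSign R s i * faceSign R s i = 1 := by
  rw [faceSign, ← mul_pow]; simp

theorem faceSign_erase_of_lt {s : Finset κ} {i j : κ} (hij : i < j) :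
    faceSign R (s.erase j) i = faceSign R s i := by
  unfold faceSign
  congr 2
  ext a
  simp only [Finset.mem_filter, Finset.mem_erase]
  constructor
  · rintro ⟨⟨_, h⟩, h'⟩; exact ⟨h, h'⟩
  · rintro ⟨h, h'⟩; exact ⟨⟨(h'.trans hij).ne, h⟩, h'⟩

theorem faceSign_erase_of_gt {s : Finset κ} {i j : κ} (hi : i ∈ s) (hij : i < j) :
    faceSign R (s.erase i) j = - faceSign R s j := by
  unfold faceSign
  have hmem : i ∈ s.filter (· < j) := Finset.mem_filter.2 ⟨hi, hij⟩
  rw [Finset.filter_erase, ← Finset.card_erase_add_one hmem, pow_succ]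
  ring

/-- The signs of the two ways of deleting two vertices are opposite. -/
theorem faceSign_mul_faceSign_erase {s : Finset κ} {i j : κ} (hi : i ∈ s) (hj : j ∈ s)
    (hij : i ≠ j) :
    faceSign R s i * faceSign R (s.erase i) j = - (faceSign R s j * faceSign R (s.erase j) i) := by
  rcases lt_or_gt_of_ne hij with h | h
  · rw [faceSign_erase_of_lt R h, faceSign_erase_of_gt R hi h]; ring
  · rw [faceSign_erase_of_lt R h, faceSign_erase_of_gt R hj h]; ring

/-- The boundary of the augmented chain complex of the full simplex on `κ`, in all degrees at
once. -/
noncomputable def simplexBoundary : (Finset κ →₀ R) →ₗ[R] (Finset κ →₀ R) :=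
  Finsupp.linearCombination R fun s => ∑ i ∈ s, Finsupp.single (s.erase i) (faceSign R s i)

variable {R}

theorem simplexBoundary_single (s : Finset κ) (r : R) :
    simplexBoundary R (Finsupp.single s r) =
      ∑ i ∈ s, Finsupp.single (s.erase i) (r * faceSign R s i) := by
  simp [simplexBoundary, Finset.smul_sum]

theorem simplexBoundary_boundary (c : Finset κ →₀ R) :
    simplexBoundary R (simplexBoundary R c) = 0 := by
  induction c using Finsupp.induction_linear with
  | zero => simp
  | add f g hf hg => simp [hf, hg]
  | single s r =>
    simp only [simplexBoundary_single, map_sum]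
    rw [Finset.sum_sigma' s (fun i => s.erase i)
      (fun i j => Finsupp.single ((s.erase i).erase j)
        (r * faceSign R s i * faceSign R (s.erase i) j))]
    -- Deleting `i` then `j` cancels against deleting `j` then `i`.
    refine Finset.sum_involution (fun a _ => ⟨a.2, a.1⟩) ?_ ?_ ?_ ?_
    · rintro ⟨i, j⟩ h
      simp only [Finset.mem_sigma, Finset.mem_erase] at h
      rw [Finset.erase_right_comm, ← Finsupp.single_add, mul_assoc, mul_assoc,
        faceSign_mul_faceSign_erase R h.1 h.2.2 (Ne.symm h.2.1)]
      simp
    · rintro ⟨i, j⟩ h _ heq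
      simp only [Finset.mem_sigma, Finset.mem_erase] at h
      simp only [Sigma.mk.injEq] at heq
      exact h.2.1 heq.1
    · rintro ⟨i, j⟩ h
      simp only [Finset.mem_sigma, Finset.mem_erase] at h ⊢
      exact ⟨h.2.2, Ne.symm h.2.1, h.1⟩
    · rintro ⟨i, j⟩ h
      rfl

/-- The incidence coefficients are `±1`, so additivity of `f` suffices; this allows `f` to be the
extraction of one coefficient of a polynomial, which is not multiplicative. -/
theorem simplexBoundary_mapRange {R' : Type*} [CommRing R'] (f : R →+ R') (c : Finset κ →₀ R) :
    simplexBoundary R' (Finsupp.mapRange.addMonoidHom f c) =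
      Finsupp.mapRange.addMonoidHom f (simplexBoundary R c) := by
  induction c using Finsupp.induction_linear with
  | zero => simp
  | add a b ha hb => simp only [map_add, ha, hb]
  | single s r =>
    simp only [simplexBoundary_single, map_sum, Finsupp.mapRange.addMonoidHom_apply,
      Finsupp.mapRange_single]
    refine Finset.sum_congr rfl fun i _ => ?_
    congr 1
    rcases neg_one_pow_eq_or R (s.filter (· < i)).card with h | h
    all_goals
      rcases Nat.even_or_odd (s.filter (· < i)).card with h' | h' <;>
      simp [faceSign, h'.neg_one_pow]

theorem simplexBoundary_filter_card (j : ℕ) (c : Finset κ →₀ R) :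
    simplexBoundary R (c.filter fun s => s.card = j + 1) =
      (simplexBoundary R c).filter fun s => s.card = j := by
  induction c using Finsupp.induction_linear with
  | zero => rw [Finsupp.filter_zero, map_zero, Finsupp.filter_zero]
  | add a b ha hb => simp only [Finsupp.filter_add, map_add, ha, hb]
  | single s r =>
    have hcard : ∀ i ∈ s, ((s.erase i).card = j ↔ s.card = j + 1) := fun i hi => by
      have := Finset.card_erase_add_one hi
      omega
    rw [simplexBoundary_single, Finsupp.filter_sum]
    by_cases h : s.card = j + 1
    · rw [Finsupp.filter_single_of_pos (fun t : Finset κ => t.card = j + 1) h, simplexBoundary_single]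
      exact Finset.sum_congr rfl fun i hi =>
        (Finsupp.filter_single_of_pos (fun t : Finset κ => t.card = j)
          ((hcard i hi).2 h)).symm
    · rw [Finsupp.filter_single_of_neg (fun t : Finset κ => t.card = j + 1) h, map_zero]
      exact (Finset.sum_eq_zero fun i hi =>
        Finsupp.filter_single_of_neg (fun t : Finset κ => t.card = j)
          (fun h' => h ((hcard i hi).1 h'))).symm

theorem map_supported_le {α β : Type*} (f : (α →₀ R) →ₗ[R] (β →₀ R)) {s : Set α} {t : Set β}
    (h : ∀ a ∈ s, f (Finsupp.single a 1) ∈ Finsupp.supported R R t) {c : α →₀ R}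
    (hc : c ∈ Finsupp.supported R R s) : f c ∈ Finsupp.supported R R t := by
  rw [Finsupp.supported_eq_span_single] at hc
  have : Submodule.span R ((fun i => Finsupp.single i (1 : R)) '' s) ≤
      (Finsupp.supported R R t).comap f := by
    rw [Submodule.span_le]
    rintro _ ⟨a, ha, rfl⟩
    exact h a ha
  exact this hc

end SimplexChains

/-! ### Acyclicity by an algebraic matching. -/

section Matching

open scoped Classical

variable {κ : Type*} [LinearOrder κ] (R : Type*) [CommRing R]
  (P : Set (Finset κ)) (T : Set κ) (v : Finset κ → κ)

/-- The part of a face that lies outside `T`. -/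
noncomputable def outerPart (s : Finset κ) : Finset κ := s.filter (· ∉ T)

/-- The homotopy of the matching that toggles the vertex `v (outerPart T s)` of the faces `s`
outside `P`. -/
noncomputable def matchingHomotopy : (Finset κ →₀ R) →ₗ[R] (Finset κ →₀ R) :=
  Finsupp.linearCombination R fun s =>
    if s ∈ P ∨ v (outerPart T s) ∈ s then 0
    else Finsupp.single (insert (v (outerPart T s)) s)
      (faceSign R (insert (v (outerPart T s)) s) (v (outerPart T s)))

variable {R P T v}

theorem matchingHomotopy_of_or {s : Finset κ} (h : s ∈ P ∨ v (outerPart T s) ∈ s) (r : R) :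
    matchingHomotopy R P T v (Finsupp.single s r) = 0 := by
  rw [matchingHomotopy, Finsupp.linearCombination_single, if_pos h, smul_zero]

theorem matchingHomotopy_of_not {s : Finset κ} (h : ¬ (s ∈ P ∨ v (outerPart T s) ∈ s)) (r : R) :
    matchingHomotopy R P T v (Finsupp.single s r) =
      Finsupp.single (insert (v (outerPart T s)) s)
        (r * faceSign R (insert (v (outerPart T s)) s) (v (outerPart T s))) := by
  rw [matchingHomotopy, Finsupp.linearCombination_single, if_neg h, Finsupp.smul_single,
    smul_eq_mul]

theorem matchingHomotopy_of_supported {c : Finset κ →₀ R} (hc : c ∈ Finsupp.supported R R P) :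
    matchingHomotopy R P T v c = 0 := by
  have := map_supported_le (t := ∅) (matchingHomotopy R P T v) (fun s hs => by
    rw [matchingHomotopy_of_or (Or.inl hs)]; exact zero_mem _) hc
  simpa [Finsupp.supported_empty] using this

theorem mem_outerPart {κ : Type*} {T : Set κ} {s : Finset κ} {i : κ} : i ∈ outerPart T s ↔ i ∈ s ∧ i ∉ T := by
  rw [outerPart, Finset.mem_filter]

theorem outerPart_insert {s : Finset κ} {i : κ} (hi : i ∈ T) :
    outerPart T (insert i s) = outerPart T s := by
  simp [outerPart, Finset.filter_insert, hi]

theorem outerPart_erase {s : Finset κ} {i : κ} (hi : i ∈ T) :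
    outerPart T (s.erase i) = outerPart T s := by
  ext a
  simp only [outerPart, Finset.mem_filter, Finset.mem_erase]
  constructor
  · rintro ⟨⟨_, h⟩, h'⟩; exact ⟨h, h'⟩
  · rintro ⟨h, h'⟩; exact ⟨⟨fun e => h' (e ▸ hi), h⟩, h'⟩

theorem card_outerPart_erase_lt {s : Finset κ} {i : κ} (his : i ∈ s) (hi : i ∉ T) :
    (outerPart T (s.erase i)).card < (outerPart T s).card := by
  refine Finset.card_lt_card (Finset.ssubset_iff_of_subset ?_ |>.2 ⟨i, ?_, ?_⟩)
  · exact Finset.filter_subset_filter _ (Finset.erase_subset _ _)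
  · simp [outerPart, his, hi]
  · simp [outerPart]

/-- The faces of `Γ` that lie in `P` or have fewer than `N` vertices outside `T`. -/
noncomputable def lowFaces (Γ P : Set (Finset κ)) (T : Set κ) (N : ℕ) : Set (Finset κ) :=
  {s | s ∈ Γ ∧ (s ∈ P ∨ (outerPart T s).card < N)}

variable {Γ : Set (Finset κ)}

/-- Up to the homotopy of the matching, faces outside `P` may be pushed to faces with fewer vertices
outside `T`. -/
theorem sub_homotopy_mem_lowFaces
    (hΓ : ∀ s ∈ Γ, ∀ i ∈ s, s.erase i ∈ Γ) (hP : ∀ s ∈ P, ∀ i ∈ s, s.erase i ∈ P)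
    (hvT : ∀ D, v D ∈ T)
    (hins : ∀ s ∈ Γ, s ∉ P → insert (v (outerPart T s)) s ∈ Γ)
    (hera : ∀ s, s ∉ P → s.erase (v (outerPart T s)) ∉ P)
    {N : ℕ} {s : Finset κ} (hs : s ∈ lowFaces Γ P T (N + 1)) :
    (Finsupp.single s (1 : R) - simplexBoundary R (matchingHomotopy R P T v (Finsupp.single s 1))
      - matchingHomotopy R P T v (simplexBoundary R (Finsupp.single s 1)))
      ∈ Finsupp.supported R R (lowFaces Γ P T N) := by
  obtain ⟨hsΓ, hsN⟩ := hs
  by_cases hsP : s ∈ P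
  · rw [matchingHomotopy_of_or (Or.inl hsP), matchingHomotopy_of_supported]
    · simpa using Finsupp.single_mem_supported R (1 : R)
        (show s ∈ lowFaces Γ P T N from ⟨hsΓ, Or.inl hsP⟩)
    · rw [simplexBoundary_single]
      exact sum_mem fun i hi => Finsupp.single_mem_supported R _ (hP s hsP i hi)
  have hN : (outerPart T s).card < N + 1 := hsN.resolve_left hsP
  -- Deleting a vertex outside `T` lowers the outer count, and the vertex that `h` then inserts lies
  -- in `T`, so it does not raise it again.
  have houter : ∀ i ∈ s, i ∉ T → ∀ r : R,
      matchingHomotopy R P T v (Finsupp.single (s.erase i) r) ∈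
        Finsupp.supported R R (lowFaces Γ P T N) := by
    intro i hi hiT r
    by_cases h : s.erase i ∈ P ∨ v (outerPart T (s.erase i)) ∈ s.erase i
    · rw [matchingHomotopy_of_or h]; exact zero_mem _
    · rw [matchingHomotopy_of_not h]
      refine Finsupp.single_mem_supported R _
        ⟨hins _ (hΓ s hsΓ i hi) (fun h' => h (Or.inl h')), Or.inr ?_⟩
      rw [outerPart_insert (hvT _)]
      have := card_outerPart_erase_lt hi hiT
      omega
  set x := v (outerPart T s) with hx
  have hxT : x ∈ T := hvT _
  have hvera : ∀ i ∈ T, v (outerPart T (s.erase i)) = x := fun i hi => by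
    rw [outerPart_erase hi]
  by_cases hxs : x ∈ s
  · rw [matchingHomotopy_of_or (Or.inr hxs), map_zero, sub_zero, simplexBoundary_single, map_sum,
      ← Finset.add_sum_erase _ _ hxs]
    -- Here `h s = 0`, and the term of `h∂s` coming from the deletion of `x` is `s` itself,
    -- cancelling the identity. Deleting another vertex of `T` leaves `x` in the face, where `h`
    -- vanishes.
    have h1 : ¬ (s.erase x ∈ P ∨ v (outerPart T (s.erase x)) ∈ s.erase x) := by
      rw [hvera x hxT]
      simpa using hera s hsP
    rw [matchingHomotopy_of_not h1, hvera x hxT, Finset.insert_erase hxs, one_mul,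
      faceSign_mul_self, sub_add_cancel_left]
    refine neg_mem (sum_mem fun i hi => ?_)
    obtain ⟨hix, his⟩ := Finset.mem_erase.1 hi
    by_cases hiT : i ∈ T
    · rw [matchingHomotopy_of_or]
      · exact zero_mem _
      · right
        rw [hvera i hiT]
        exact Finset.mem_erase.2 ⟨hix.symm, hxs⟩
    · exact houter i his hiT _
  · have h0 : ¬ (s ∈ P ∨ v (outerPart T s) ∈ s) := not_or.2 ⟨hsP, hxs⟩
    rw [matchingHomotopy_of_not h0, ← hx, simplexBoundary_single, simplexBoundary_single,
      Finset.sum_insert hxs, Finset.erase_insert hxs, one_mul, faceSign_mul_self, map_sum,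
      sub_add_cancel_left, ← Finset.sum_neg_distrib, ← Finset.sum_sub_distrib]
    refine sum_mem fun i hi => ?_
    have hix : i ≠ x := fun h => hxs (h ▸ hi)
    have hcomm : (insert x s).erase i = insert x (s.erase i) :=
      Finset.erase_insert_of_ne hix.symm
    have hΓ' : (insert x s).erase i ∈ Γ :=
      hΓ _ (hins s hsΓ hsP) i (Finset.mem_insert_of_mem hi)
    by_cases hiT : i ∈ T
    · by_cases hiP : s.erase i ∈ P
      · rw [matchingHomotopy_of_or (Or.inl hiP), sub_zero]
        refine neg_mem (Finsupp.single_mem_supported R _ ⟨hΓ', Or.inl ?_⟩)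
        -- Toggling `x` preserves the complement of `P`: were this face outside `P`, so would be
        -- `s.erase i`.
        by_contra h
        have h2 := hera _ h
        rw [outerPart_erase hiT, outerPart_insert hxT, ← hx, hcomm, Finset.erase_insert] at h2
        · exact h2 hiP
        · exact fun h' => hxs (Finset.mem_of_mem_erase h')
      · have h1 : ¬ (s.erase i ∈ P ∨ v (outerPart T (s.erase i)) ∈ s.erase i) := by
          rw [hvera i hiT]
          exact not_or.2 ⟨hiP, fun h' => hxs (Finset.mem_of_mem_erase h')⟩
        rw [matchingHomotopy_of_not h1, hvera i hiT, ← hcomm, ← Finsupp.single_neg,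
          ← Finsupp.single_sub]
        have key := faceSign_mul_faceSign_erase R (Finset.mem_insert_of_mem hi)
          (Finset.mem_insert_self x s) hix
        rw [Finset.erase_insert hxs] at key
        have hi1 := faceSign_mul_self R s i
        have hi2 := faceSign_mul_self R (insert x s) i
        -- The face `(insert x s).erase i` occurs in both `∂h s` and `h∂s`; the two occurrences
        -- cancel because deleting `x` and `i` in either order gives opposite signs.
        have : -(faceSign R (insert x s) x * faceSign R (insert x s) i) -
            1 * faceSign R s i * faceSign R ((insert x s).erase i) x = 0 := by
          linear_combination
            (-(faceSign R s i * faceSign R (insert x s) i)) * key +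
              (faceSign R s i * faceSign R ((insert x s).erase i) x) * hi2
              + (faceSign R (insert x s) i * faceSign R (insert x s) x) * hi1
        rw [this, Finsupp.single_zero]
        exact zero_mem _
    · refine sub_mem (neg_mem (Finsupp.single_mem_supported R _ ⟨hΓ', Or.inr ?_⟩))
        (houter i hi hiT _)
      have := card_outerPart_erase_lt (Finset.mem_insert_of_mem hi : i ∈ insert x s) hiT
      rw [outerPart_insert hxT] at this
      omega

/-- The cone over a cycle bounds it. -/
theorem exists_simplexBoundary_eq_of_insert_mem
    (hΓ : ∀ s ∈ Γ, ∀ i ∈ s, s.erase i ∈ Γ) (x : κ) (hx : ∀ s ∈ Γ, insert x s ∈ Γ)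
    {z : Finset κ →₀ R} (hz : z ∈ Finsupp.supported R R Γ) (hz0 : simplexBoundary R z = 0) :
    ∃ w ∈ Finsupp.supported R R Γ, simplexBoundary R w = z := by
  -- The cone is the matching with `P = ∅` and `T` everything: outer parts are empty, so the error
  -- term lies in `lowFaces` with `N = 0`, which is empty, and the homotopy identity is exact.
  set h := matchingHomotopy R (∅ : Set (Finset κ)) Set.univ (fun _ => x) with hh
  refine ⟨h z, map_supported_le h (fun s hs => ?_) hz, ?_⟩
  · by_cases hs' : s ∈ (∅ : Set (Finset κ)) ∨ x ∈ s
    · rw [hh, matchingHomotopy_of_or hs']; exact zero_mem _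
    · rw [hh, matchingHomotopy_of_not hs']
      exact Finsupp.single_mem_supported R _ (hx s hs)
  · have key := map_supported_le (t := lowFaces Γ ∅ Set.univ 0)
      (LinearMap.id - simplexBoundary R ∘ₗ h - h ∘ₗ simplexBoundary R)
      (fun s (hs : s ∈ Γ) => by
        refine sub_homotopy_mem_lowFaces hΓ (by simp) (by simp) (fun s hs _ => hx s hs)
          (by simp) (N := 0) ⟨hs, Or.inr ?_⟩
        simp [outerPart]) hz
    have hempty : lowFaces Γ ∅ (Set.univ : Set κ) 0 = ∅ := by
      ext s; simp [lowFaces]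
    rw [hempty, Finsupp.supported_empty, Submodule.mem_bot] at key
    simp only [LinearMap.sub_apply, LinearMap.comp_apply, LinearMap.id_apply, hz0, map_zero,
      sub_zero] at key
    exact (sub_eq_zero.1 key).symm

/-- If `Γ` is a cone and the faces of `Γ` outside the subcomplex `P` are matched by toggling
vertices of `T` that depend only on the part of the face outside `T`, then the subcomplex of faces
of `Γ` in `P` is acyclic. -/
theorem exists_simplexBoundary_eq_of_matching
    (hΓ : ∀ s ∈ Γ, ∀ i ∈ s, s.erase i ∈ Γ) (hP : ∀ s ∈ P, ∀ i ∈ s, s.erase i ∈ P)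
    (hvT : ∀ D, v D ∈ T)
    (hins : ∀ s ∈ Γ, s ∉ P → insert (v (outerPart T s)) s ∈ Γ)
    (hera : ∀ s, s ∉ P → s.erase (v (outerPart T s)) ∉ P)
    (x : κ) (hx : ∀ s ∈ Γ, insert x s ∈ Γ)
    {z : Finset κ →₀ R} (hz : z ∈ Finsupp.supported R R (Γ ∩ P)) (hz0 : simplexBoundary R z = 0) :
    ∃ w ∈ Finsupp.supported R R (Γ ∩ P), simplexBoundary R w = z := by
  have hzP : z ∈ Finsupp.supported R R P := Finsupp.supported_mono Set.inter_subset_right hz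
  have descend : ∀ N : ℕ, ∀ w ∈ Finsupp.supported R R (lowFaces Γ P T N),
      simplexBoundary R w = z →
      ∃ w ∈ Finsupp.supported R R (Γ ∩ P), simplexBoundary R w = z := by
    intro N
    induction N with
    | zero =>
      intro w hw hwz
      refine ⟨w, Finsupp.supported_mono ?_ hw, hwz⟩
      rintro s ⟨h1, h2⟩
      exact ⟨h1, h2.resolve_right (Nat.not_lt_zero _)⟩
    | succ N ih =>
      intro w hw hwz
      -- Since `∂w = z` is supported in `P`, `h∂w = 0`; hence this chain equals `(id - ∂h - h∂) w`,
      -- and it still bounds `z`.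
      refine ih (w - simplexBoundary R (matchingHomotopy R P T v w)) ?_ ?_
      · have key := map_supported_le (LinearMap.id -
          simplexBoundary R ∘ₗ matchingHomotopy R P T v -
          matchingHomotopy R P T v ∘ₗ simplexBoundary R)
          (fun s hs => sub_homotopy_mem_lowFaces (R := R) hΓ hP hvT hins hera hs) hw
        simpa [hwz, matchingHomotopy_of_supported hzP] using key
      · rw [map_sub, simplexBoundary_boundary, sub_zero, hwz]
  obtain ⟨w, hw, hwz⟩ := exists_simplexBoundary_eq_of_insert_mem hΓ x hx
    (Finsupp.supported_mono Set.inter_subset_left hz) hz0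
  refine descend (w.support.sup (fun s => (outerPart T s).card) + 1) w ?_ hwz
  rw [Finsupp.mem_supported] at hw ⊢
  intro s hs
  exact ⟨hw hs, Or.inr (Nat.lt_succ_of_le
    (Finset.le_sup (f := fun s => (outerPart T s).card) hs))⟩

end Matching

/-! ### From exactness over the polynomial ring to acyclicity in each multidegree. -/

section Homogenization

variable {ι : Type*} {κ : Type*} (g : κ → (ι →₀ ℕ)) (K : Type*) [Field K]

theorem mdeg_mono {s t : Finset κ} (h : s ⊆ t) : mdeg g s ≤ mdeg g t := Finset.sup_mono h

/-- The embedding of the Scarf complex into the chains of the full simplex which multiplies each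
basis element by its multidegree. -/
noncomputable def scarfToSimplex (j : ℕ) :
    ScarfModule g K j →ₗ[MvPolynomial ι K] (Finset κ →₀ MvPolynomial ι K) :=
  Finsupp.linearCombination (MvPolynomial ι K) fun s : ScarfFace g j =>
    Finsupp.single s.1 (monomial (mdeg g s.1) 1)

theorem scarfToSimplex_single (j : ℕ) (s : ScarfFace g j) (p : MvPolynomial ι K) :
    scarfToSimplex g K j (Finsupp.single s p) =
      Finsupp.single s.1 (p * monomial (mdeg g s.1) 1) := by
  simp [scarfToSimplex]

theorem scarfToSimplex_apply (j : ℕ) (f : ScarfModule g K j) (s : ScarfFace g j) :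
    scarfToSimplex g K j f s.1 = f s * monomial (mdeg g s.1) 1 := by
  classical
  induction f using Finsupp.induction_linear with
  | zero => simp
  | add a b ha hb => simp only [map_add, Finsupp.add_apply, ha, hb, add_mul]
  | single t p =>
    rw [scarfToSimplex_single]
    by_cases h : t = s
    · subst h; simp
    · rw [Finsupp.single_eq_of_ne (Ne.symm h), Finsupp.single_eq_of_ne, zero_mul]
      exact fun h' => h (Subtype.ext h'.symm)

theorem scarfToSimplex_injective (j : ℕ) : Function.Injective (scarfToSimplex g K j) := by
  intro f f' h
  ext1 s
  have := DFunLike.congr_fun h s.1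
  rw [scarfToSimplex_apply, scarfToSimplex_apply] at this
  exact mul_right_cancel₀ (by simp [monomial_eq_zero]) this

/-- The rescaling absorbs the monomial coefficients, since the quotient `mdeg s / mdeg (s \ {i})`
times `mdeg (s \ {i})` is `mdeg s`; only the signs remain. -/
theorem simplexBoundary_scarfToSimplex [LinearOrder κ] (j : ℕ) (f : ScarfModule g K (j + 1)) :
    simplexBoundary _ (scarfToSimplex g K (j + 1) f) =
      scarfToSimplex g K j (scarfD g K j f) := by
  induction f using Finsupp.induction_linear with
  | zero => simp
  | add a b ha hb => simp only [map_add, ha, hb]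
  | single s p =>
    rw [scarfToSimplex_single, simplexBoundary_single, scarfD, Finsupp.linearCombination_single,
      map_smul, map_sum, Finset.smul_sum, ← Finset.sum_coe_sort]
    refine Finset.sum_congr rfl fun i _ => ?_
    rw [scarfToSimplex_single, Finsupp.smul_single, smul_eq_mul]
    change Finsupp.single (s.1.erase i.1) _ = Finsupp.single (s.1.erase i.1) _
    congr 1
    rw [mul_assoc]
    congr 1
    have hle : mdeg g (s.1.erase i.1) ≤ mdeg g s.1 := mdeg_mono g (Finset.erase_subset _ _)
    change _ = facetCoeff g K s.1 i.1 * monomial (mdeg g (s.1.erase i.1)) 1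
    rw [facetCoeff, monomial_mul, tsub_add_cancel_of_le hle, mul_one, faceSign]
    have : ((-1 : MvPolynomial ι K) ^ (s.1.filter (· < i.1)).card) =
        C ((-1 : K) ^ (s.1.filter (· < i.1)).card) := by simp
    rw [this, mul_comm, C_mul_monomial, mul_one]

/-- The chains of the full simplex that come from the Scarf complex. -/
def IsScarfChain {K : Type*} [Field K] (c : Finset κ →₀ MvPolynomial ι K) : Prop :=
  ∀ s b, coeff b (c s) ≠ 0 → s ∈ scarfFaces g ∧ mdeg g s ≤ b

variable {g K}

theorem isScarfChain_scarfToSimplex (j : ℕ) (f : ScarfModule g K j) :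
    IsScarfChain g (scarfToSimplex g K j f) := by
  classical
  induction f using Finsupp.induction_linear with
  | zero => intro s b h; simp at h
  | add f₁ f₂ h₁ h₂ =>
    intro s b h
    rw [map_add, Finsupp.add_apply, coeff_add] at h
    by_cases h' : coeff b (scarfToSimplex g K j f₁ s) = 0
    · exact h₂ s b (by rwa [h', zero_add] at h)
    · exact h₁ s b h'
  | single t p =>
    intro s b h
    rw [scarfToSimplex_single] at h
    by_cases hst : s = t.1
    · subst hst
      refine ⟨t.2.1, ?_⟩
      rw [Finsupp.single_eq_same, coeff_mul_monomial'] at h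
      by_contra h'
      simp [h'] at h
    · rw [Finsupp.single_eq_of_ne hst] at h
      simp at h

theorem scarfToSimplex_filter_card (j : ℕ) (f : ScarfModule g K j) :
    (scarfToSimplex g K j f).filter (fun s => s.card = j) = scarfToSimplex g K j f := by
  induction f using Finsupp.induction_linear with
  | zero => rw [map_zero, Finsupp.filter_zero]
  | add a b ha hb => rw [map_add, Finsupp.filter_add, ha, hb]
  | single t p =>
    rw [scarfToSimplex_single,
      Finsupp.filter_single_of_pos (fun s : Finset κ => s.card = j) t.2.2]

theorem exists_scarfToSimplex_eq (j : ℕ) {c : Finset κ →₀ MvPolynomial ι K}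
    (hc : IsScarfChain g c) :
    ∃ f, scarfToSimplex g K j f = c.filter fun s => s.card = j := by
  suffices h : c.filter (fun s => s.card = j) ∈ LinearMap.range (scarfToSimplex g K j) from h
  rw [Finsupp.filter_eq_sum]
  refine sum_mem fun s hs => ?_
  obtain ⟨hs, hcard⟩ := Finset.mem_filter.1 hs
  obtain ⟨b, hb⟩ := (MvPolynomial.ne_zero_iff.1 (Finsupp.mem_support_iff.1 hs))
  have hdvd : monomial (mdeg g s) 1 ∣ c s := by
    rw [(c s).as_sum]
    refine Finset.dvd_sum fun b hb => ⟨monomial (b - mdeg g s) (coeff b (c s)), ?_⟩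
    rw [monomial_mul, add_tsub_cancel_of_le (hc s b (mem_support_iff.1 hb)).2, one_mul]
  obtain ⟨q, hq⟩ := hdvd
  refine ⟨Finsupp.single ⟨s, (hc s b hb).1, hcard⟩ q, ?_⟩
  refine (scarfToSimplex_single g K j _ q).trans ?_
  rw [hq, mul_comm]

variable [LinearOrder κ]

/-- Acyclicity of the Scarf complex in a multidegree `b`: the subcomplex of Scarf faces whose
multidegree divides `b` is acyclic. -/
def ScarfAcyclicAt (g : κ → (ι →₀ ℕ)) (K : Type*) [Field K] (b : ι →₀ ℕ) : Prop :=
  ∀ z ∈ Finsupp.supported K K ({s | mdeg g s ≤ b} ∩ scarfFaces g), simplexBoundary K z = 0 →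
    ∃ w ∈ Finsupp.supported K K ({s | mdeg g s ≤ b} ∩ scarfFaces g), simplexBoundary K w = z

/-- The boundary has constant coefficients, so it acts on each multidegree separately: each strand
of `z` is bounded over `K`, and the finitely many bounding chains are reassembled. The hypothesis
`hdeg` supplies the cone apex in each nonzero strand. -/
theorem exists_isScarfChain_simplexBoundary_eq
    (hacyc : ∀ x b, g x ≤ b → ScarfAcyclicAt g K b)
    {z : Finset κ →₀ MvPolynomial ι K} (hz : IsScarfChain g z)
    (hdeg : ∀ s b, coeff b (z s) ≠ 0 → ∃ x, g x ≤ b) (hz0 : simplexBoundary _ z = 0) :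
    ∃ w, IsScarfChain g w ∧ simplexBoundary _ w = z := by
  classical
  let co : (ι →₀ ℕ) → (Finset κ →₀ MvPolynomial ι K) →+ (Finset κ →₀ K) := fun b =>
    Finsupp.mapRange.addMonoidHom (lcoeff K b).toAddMonoidHom
  let mo : (ι →₀ ℕ) → (Finset κ →₀ K) →+ (Finset κ →₀ MvPolynomial ι K) := fun b =>
    Finsupp.mapRange.addMonoidHom (monomial b).toAddMonoidHom
  have hco : ∀ b c s, co b c s = coeff b (c s) := fun b c s => rfl
  have hmo : ∀ b c s, mo b c s = monomial b (c s) := fun b c s => rfl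
  have strand : ∀ b, ∃ w ∈ Finsupp.supported K K ({s | mdeg g s ≤ b} ∩ scarfFaces g),
      simplexBoundary K w = co b z := by
    intro b
    by_cases h : co b z = 0
    · exact ⟨0, zero_mem _, by rw [h, map_zero]⟩
    · obtain ⟨s, hs⟩ := Finsupp.ne_iff.1 h
      obtain ⟨x, hx⟩ := hdeg s b hs
      refine hacyc x b hx _ ?_ ?_
      · rw [Finsupp.mem_supported]
        intro t ht
        have := hz t b (Finsupp.mem_support_iff (f := co b z).1 ht)
        exact ⟨this.2, this.1⟩
      · rw [simplexBoundary_mapRange, hz0, map_zero]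
  choose w hw hwz using strand
  let B : Finset (ι →₀ ℕ) := z.support.biUnion fun s => (z s).support
  refine ⟨∑ b ∈ B, mo b (w b), ?_, ?_⟩
  · intro s b h
    rw [Finsupp.finsetSum_apply, coeff_sum] at h
    obtain ⟨b', -, h'⟩ := Finset.exists_ne_zero_of_sum_ne_zero h
    rw [hmo, coeff_monomial] at h'
    have hbb : b' = b := by by_contra hne; simp [hne] at h'
    subst hbb
    rw [if_pos rfl] at h'
    have := (Finsupp.mem_supported _ _).1 (hw b') (Finsupp.mem_support_iff.2 h')
    exact ⟨this.2, this.1⟩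
  · rw [map_sum]
    have : ∀ b ∈ B, simplexBoundary (MvPolynomial ι K) (mo b (w b)) = mo b (co b z) :=
      fun b _ => by rw [simplexBoundary_mapRange, hwz]
    rw [Finset.sum_congr rfl this]
    ext1 s
    rw [Finsupp.finsetSum_apply]
    simp only [hmo, hco]
    conv_rhs => rw [(z s).as_sum]
    refine (Finset.sum_subset ?_ ?_).symm
    · intro b hb
      refine Finset.mem_biUnion.2 ⟨s, ?_, hb⟩
      rw [Finsupp.mem_support_iff]
      intro h
      simp [h] at hb
    · intro b _ hb
      rw [notMem_support_iff.1 hb, monomial_zero]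

theorem exact_scarfD (hacyc : ∀ x b, g x ≤ b → ScarfAcyclicAt g K b) (j : ℕ) :
    Function.Exact (scarfD g K (j + 1)) (scarfD g K j) := by
  intro y
  constructor
  · intro hy
    obtain ⟨w, hw, hwz⟩ := exists_isScarfChain_simplexBoundary_eq hacyc
      (isScarfChain_scarfToSimplex (j + 1) y) (fun s b hb => by
        have h1 := (isScarfChain_scarfToSimplex (j + 1) y s b hb).2
        have hcard : s.card = j + 1 := by
          by_contra h
          rw [← scarfToSimplex_filter_card,
            Finsupp.filter_apply_neg (fun s : Finset κ => s.card = j + 1) _ h] at hb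
          simp at hb
        obtain ⟨x, hx⟩ := Finset.card_pos.1 (by omega : 0 < s.card)
        exact ⟨x, (Finset.le_sup hx).trans h1⟩)
      (by rw [simplexBoundary_scarfToSimplex, hy, map_zero])
    -- The bounding chain may mix dimensions; truncating it to faces with `j + 2` vertices keeps its
    -- boundary, since the cycle is homogeneous.
    obtain ⟨f, hf⟩ := exists_scarfToSimplex_eq (j + 2) hw
    refine ⟨f, scarfToSimplex_injective g K (j + 1) ?_⟩
    rw [← simplexBoundary_scarfToSimplex, hf, simplexBoundary_filter_card, hwz,
      scarfToSimplex_filter_card]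
  · rintro ⟨f, rfl⟩
    apply scarfToSimplex_injective g K j
    rw [← simplexBoundary_scarfToSimplex, ← simplexBoundary_scarfToSimplex,
      simplexBoundary_boundary, map_zero]

theorem facetCoeff_mem_span_X {s : Finset κ} (hs : s ∈ scarfFaces g) {i : κ} (hi : i ∈ s) :
    facetCoeff g K s i ∈ Ideal.span (Set.range (X : ι → MvPolynomial ι K)) := by
  have hne : mdeg g s - mdeg g (s.erase i) ≠ 0 := by
    intro h
    have h1 := hs (s.erase i) (le_antisymm (mdeg_mono g (Finset.erase_subset _ _))
      (tsub_eq_zero_iff_le.1 h))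
    exact Finset.erase_eq_self.1 h1 hi
  obtain ⟨x, hx⟩ := Finsupp.ne_iff.1 hne
  rw [← Set.image_univ, facetCoeff, mem_ideal_span_X_image]
  intro m hm
  refine ⟨x, Set.mem_univ _, ?_⟩
  rw [Finset.mem_singleton.1 (support_monomial_subset hm)]
  exact hx

theorem range_scarfD_le (j : ℕ) : LinearMap.range (scarfD g K j) ≤
    Ideal.span (Set.range (X : ι → MvPolynomial ι K)) • (⊤ : Submodule _ (ScarfModule g K j)) := by
  rw [scarfD, Finsupp.range_linearCombination, Submodule.span_le]
  rintro _ ⟨s, rfl⟩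
  refine sum_mem fun i _ => ?_
  have : Finsupp.single (s.facet g i) (facetCoeff g K s.1 i.1) =
      facetCoeff g K s.1 i.1 • Finsupp.single (s.facet g i) (1 : MvPolynomial ι K) := by
    rw [Finsupp.smul_single, smul_eq_mul, mul_one]
  rw [this]
  exact Submodule.smul_mem_smul (facetCoeff_mem_span_X s.2.1 i.2) trivial

/-- The Scarf complex is a minimal resolution as soon as it is acyclic in the multidegrees of
`M`. -/
theorem isMinimalScarfResolution_of_acyclic {M : Ideal (MvPolynomial ι K)}
    (hgM : ∀ x, monomial (g x) 1 ∈ M)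
    (hMg : ∀ p ∈ M, ∀ b, coeff b p ≠ 0 → ∃ x, g x ≤ b)
    (hpos : ∀ x, g x ≠ 0)
    (hacyc : ∀ x b, g x ≤ b → ScarfAcyclicAt g K b) :
    IsMinimalScarfResolution g M := by
  have hempty : (∅ : Finset κ) ∈ scarfFaces g := by
    intro t ht
    by_contra hne
    obtain ⟨x, hx⟩ := Finset.nonempty_iff_ne_empty.2 hne
    have : g x ≤ mdeg g t := Finset.le_sup hx
    rw [ht] at this
    exact hpos x (le_antisymm this (zero_le))
  let e : ScarfFace g 0 := ⟨∅, hempty, rfl⟩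
  have he : ∀ s : ScarfFace g 0, s = e := fun s => Subtype.ext (Finset.card_eq_zero.1 s.2.2)
  have haug : ∀ (s : ScarfFace g 0) p,
      scarfAug g M (Finsupp.single s p) = Ideal.Quotient.mk M p := by
    intro s p
    rw [scarfAug, Finsupp.linearCombination_single]
    exact (map_mul (Ideal.Quotient.mk M) p 1).symm.trans (by rw [mul_one])
  refine ⟨?_, ?_, exact_scarfD hacyc, range_scarfD_le⟩
  · intro q
    obtain ⟨p, rfl⟩ := Ideal.Quotient.mk_surjective q
    exact ⟨Finsupp.single e p, haug e p⟩
  · intro y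
    constructor
    · intro hy
      have hye : y = Finsupp.single e (y e) := by
        ext1 s
        rw [he s, Finsupp.single_eq_same]
      rw [hye, haug, Ideal.Quotient.eq_zero_iff_mem] at hy
      have hz : scarfToSimplex g K 0 y = Finsupp.single ∅ (y e) := by
        conv_lhs => rw [hye]
        rw [scarfToSimplex_single]
        have : mdeg g (∅ : Finset κ) = 0 := rfl
        change Finsupp.single ∅ (y e * monomial (mdeg g ∅) 1) = _
        rw [this, monomial_zero', map_one, mul_one]
      obtain ⟨w, hw, hwz⟩ := exists_isScarfChain_simplexBoundary_eq hacyc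
        -- In degree zero the only face is empty, so the generator below `b` comes from the
        -- membership of `y e` in `M`.
        (isScarfChain_scarfToSimplex 0 y) (fun s b hb => by
          classical
          rw [hz, Finsupp.single_apply] at hb
          split_ifs at hb
          · exact hMg _ hy b hb
          · simp at hb)
        (by rw [hz, simplexBoundary_single, Finset.sum_empty])
      obtain ⟨f, hf⟩ := exists_scarfToSimplex_eq 1 hw
      refine ⟨f, scarfToSimplex_injective g K 0 ?_⟩
      rw [← simplexBoundary_scarfToSimplex, hf, simplexBoundary_filter_card, hwz,
        scarfToSimplex_filter_card]
    · rintro ⟨f, rfl⟩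
      induction f using Finsupp.induction_linear with
      | zero => simp
      | add a b ha hb => rw [map_add, map_add, ha, hb, add_zero]
      | single s p =>
        rw [scarfD, Finsupp.linearCombination_single, map_smul, map_sum]
        rw [Finset.sum_eq_zero, smul_zero]
        intro i _
        rw [haug, Ideal.Quotient.eq_zero_iff_mem, facetCoeff]
        have h1 : s.1.erase i.1 = ∅ := by
          rw [← Finset.card_eq_zero, Finset.card_erase_of_mem i.2, s.2.2]
        have h2 : g i.1 ≤ mdeg g s.1 := Finset.le_sup i.2
        have h3 : mdeg g s.1 - mdeg g (s.1.erase i.1) = (mdeg g s.1 - g i.1) + g i.1 := by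
          rw [h1, tsub_add_cancel_of_le h2]
          exact tsub_zero _
        rw [h3, ← mul_one ((-1 : K) ^ _), ← monomial_mul]
        exact M.mul_mem_left _ (hgM _)

end Homogenization

/-! ### The matching supplied by the two nondominant generators. -/

section Semidominant

variable {ι : Type*} {κ : Type*} [LinearOrder κ] {g : κ → (ι →₀ ℕ)}

/-- A vertex with a dominant variable is detected by the multidegree. -/
theorem mem_of_mdeg_eq {i : κ} {x : ι} (hpos : 0 < g i x) (hdom : ∀ j, j ≠ i → g j x < g i x)
    {s t : Finset κ} (h : mdeg g s = mdeg g t) (hi : i ∈ s) : i ∈ t := by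
  by_contra hit
  have h1 : g i x ≤ mdeg g t x := h ▸ (Finset.le_sup hi : g i ≤ mdeg g s) x
  have h2 : ∀ u : Finset κ, i ∉ u → mdeg g u x < g i x := by
    intro u
    induction u using Finset.induction_on with
    | empty => intro _; exact hpos
    | insert a u _ ih =>
      intro hiu
      rw [Finset.mem_insert, not_or] at hiu
      have : mdeg g (insert a u) = g a ⊔ mdeg g u := Finset.sup_insert
      rw [this, Finsupp.sup_apply]
      exact max_lt (hdom a (Ne.symm hiu.1)) (ih hiu.2)
  exact (h2 t hit).not_ge h1

/-- Two monomials without common nonzero exponents have different least common multiples with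
`d`, unless one of them divides `d`. -/
theorem le_of_sup_eq_sup {d a b : ι →₀ ℕ} (hab : ∀ x, a x ≠ 0 → a x ≠ b x)
    (h : d ⊔ a = d ⊔ b) : a ≤ d := by
  intro x
  by_contra hx
  have h1 := DFunLike.congr_fun h x
  rw [Finsupp.sup_apply, Finsupp.sup_apply] at h1
  -- If `d x < a x`, equality of the maxima forces `b x = a x`, a common nonzero exponent.
  have := hab x (by omega)
  omega

/-- In the 2-semidominant case without common exponents, the faces outside the Scarf complex are
matched by toggling one of the two nondominant vertices, chosen by the dominant part of the face. -/
theorem exists_toggle {n₁ n₂ : κ}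
    (hdom : ∀ i, i ≠ n₁ → i ≠ n₂ → ∃ x, 0 < g i x ∧ ∀ j, j ≠ i → g j x < g i x)
    (hexp : ∀ x, g n₁ x ≠ 0 → g n₁ x ≠ g n₂ x) (D : Finset κ) :
    ∃ v ∈ ({n₁, n₂} : Set κ), ∀ s, outerPart {n₁, n₂} s = D → s ∉ scarfFaces g →
      g v ≤ mdeg g (s.erase v) := by
  have hexp' : ∀ x, g n₂ x ≠ 0 → g n₂ x ≠ g n₁ x := fun x h2 h => hexp x (h ▸ h2) h.symm
  set d := mdeg g D with hd
  have hDs : ∀ s, outerPart {n₁, n₂} s = D → ∀ v ∈ ({n₁, n₂} : Set κ), d ≤ mdeg g (s.erase v) := by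
    rintro s rfl v hv
    refine mdeg_mono g fun i hi => ?_
    obtain ⟨h1, h2⟩ := mem_outerPart.1 hi
    exact Finset.mem_erase.2 ⟨fun h => h2 (h ▸ hv), h1⟩
  have hm1 : n₁ ∈ ({n₁, n₂} : Set κ) := by simp
  have hm2 : n₂ ∈ ({n₁, n₂} : Set κ) := by simp
  by_cases h1 : g n₁ ≤ d
  · exact ⟨n₁, hm1, fun s hs _ => h1.trans (hDs s hs _ hm1)⟩
  by_cases h2 : g n₂ ≤ d
  · exact ⟨n₂, hm2, fun s hs _ => h2.trans (hDs s hs _ hm2)⟩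
  have hne : n₁ ≠ n₂ := by
    rintro h
    exact h1 (le_of_sup_eq_sup (b := g n₂) hexp (by rw [h]))
  have hform : ∀ s, outerPart {n₁, n₂} s = D → mdeg g s =
      d ⊔ ((if n₁ ∈ s then g n₁ else 0) ⊔ (if n₂ ∈ s then g n₂ else 0)) := by
    rintro s hs
    apply le_antisymm
    · refine Finset.sup_le fun i hi => ?_
      by_cases hi1 : i = n₁
      · subst hi1
        rw [if_pos hi]
        exact le_sup_left.trans le_sup_right
      by_cases hi2 : i = n₂
      · subst hi2
        rw [if_pos hi]
        exact le_sup_right.trans le_sup_right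
      · refine le_sup_of_le_left (Finset.le_sup (f := g) ?_)
        rw [← hs]
        exact mem_outerPart.2 ⟨hi, by simp [hi1, hi2]⟩
    · refine sup_le ((hDs s hs n₁ hm1).trans (mdeg_mono g (Finset.erase_subset _ _)))
        (sup_le ?_ ?_)
      · split_ifs with h
        · exact Finset.le_sup (f := g) h
        · exact zero_le
      · split_ifs with h
        · exact Finset.le_sup (f := g) h
        · exact zero_le
  have houter : ∀ s t, mdeg g s = mdeg g t → outerPart {n₁, n₂} s = outerPart {n₁, n₂} t := by
    intro s t hst
    ext i
    simp only [mem_outerPart, Set.mem_insert_iff, Set.mem_singleton_iff, not_or]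
    refine and_congr_left fun h => ?_
    obtain ⟨x, hx0, hx⟩ := hdom i h.1 h.2
    exact ⟨mem_of_mdeg_eq hx0 hx hst, mem_of_mdeg_eq hx0 hx hst.symm⟩
  have hsplit : ∀ s t, outerPart {n₁, n₂} s = outerPart {n₁, n₂} t → (n₁ ∈ s ↔ n₁ ∈ t) →
      (n₂ ∈ s ↔ n₂ ∈ t) → s = t := by
    intro s t hst e1 e2
    ext i
    by_cases hi1 : i = n₁
    · rw [hi1]; exact e1
    by_cases hi2 : i = n₂
    · rw [hi2]; exact e2
    have := Finset.ext_iff.1 hst i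
    simpa [mem_outerPart, hi1, hi2] using this
  -- the possible coincidences of multidegrees
  have hcases : ∀ s, outerPart {n₁, n₂} s = D → s ∉ scarfFaces g →
      (n₁ ∈ s ∧ g n₂ ≤ d ⊔ g n₁) ∨ (n₂ ∈ s ∧ g n₁ ≤ d ⊔ g n₂) := by
    intro s hs hsc
    simp only [scarfFaces, Set.mem_ofPred_eq, not_forall] at hsc
    obtain ⟨t, hts, hne'⟩ := hsc
    have ht : outerPart {n₁, n₂} t = D := (houter t s hts).trans hs
    have hnot : ¬ ((n₁ ∈ t ↔ n₁ ∈ s) ∧ (n₂ ∈ t ↔ n₂ ∈ s)) := fun h =>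
      hne' (hsplit t s (ht.trans hs.symm) h.1 h.2)
    rw [hform t ht, hform s hs] at hts
    have hz : ∀ a : ι →₀ ℕ, a ⊔ 0 = a := fun a => sup_eq_left.2 (zero_le)
    have hz' : ∀ a : ι →₀ ℕ, 0 ⊔ a = a := fun a => sup_eq_right.2 (zero_le)
    have e1 : d ⊔ g n₁ ≠ d := fun h => h1 (h ▸ le_sup_right)
    have e2 : d ⊔ g n₂ ≠ d := fun h => h2 (h ▸ le_sup_right)
    have e3 : d ⊔ (g n₁ ⊔ g n₂) ≠ d := fun h => h1 (h ▸ le_sup_left.trans le_sup_right)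
    have e4 : d ⊔ g n₁ ≠ d ⊔ g n₂ := fun h => h1 (le_of_sup_eq_sup hexp h)
    have e5 : d ⊔ (g n₁ ⊔ g n₂) = d ⊔ g n₁ → g n₂ ≤ d ⊔ g n₁ := fun h =>
      h ▸ le_sup_right.trans le_sup_right
    have e6 : d ⊔ (g n₁ ⊔ g n₂) = d ⊔ g n₂ → g n₁ ≤ d ⊔ g n₂ := fun h =>
      h ▸ le_sup_left.trans le_sup_right
    -- The cases are the traces of `s` and `t` on `{n₁, n₂}`. Equal traces contradict `hnot`;
    -- unequal ones either contradict `e1`–`e4` or give one of the two divisibilities.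
    by_cases a1 : n₁ ∈ s <;> by_cases a2 : n₂ ∈ s <;> by_cases b1 : n₁ ∈ t <;>
      by_cases b2 : n₂ ∈ t <;>
      simp only [a1, a2, b1, b2, if_true, if_false, hz, hz', iff_self, and_self,
        not_true_eq_false] at hts hnot <;>
      first
      | exact Or.inl ⟨a1, e5 hts⟩
      | exact Or.inl ⟨a1, e5 hts.symm⟩
      | exact Or.inr ⟨a2, e6 hts⟩
      | exact Or.inr ⟨a2, e6 hts.symm⟩
      | exact absurd hts e1
      | exact absurd hts.symm e1
      | exact absurd hts e2
      | exact absurd hts.symm e2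
      | exact absurd hts e3
      | exact absurd hts.symm e3
      | exact absurd hts e4
      | exact absurd hts.symm e4
  -- The two coincidences exclude each other, since together they give `d ⊔ g n₁ = d ⊔ g n₂`. If
  -- neither holds, no face over `D` is non-Scarf and the choice of `n₁` is vacuous.
  by_cases h12 : g n₂ ≤ d ⊔ g n₁
  · refine ⟨n₂, hm2, fun s hs hsc => ?_⟩
    rcases hcases s hs hsc with h | h
    · exact h12.trans (sup_le (hDs s hs _ hm2)
        (Finset.le_sup (f := g) (Finset.mem_erase.2 ⟨hne, h.1⟩)))
    · exact absurd (le_of_sup_eq_sup hexp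
        (le_antisymm (sup_le le_sup_left h.2) (sup_le le_sup_left h12))) h1
  · refine ⟨n₁, hm1, fun s hs hsc => ?_⟩
    rcases hcases s hs hsc with h | h
    · exact absurd h.2 h12
    · exact h.2.trans (sup_le (hDs s hs _ hm1)
        (Finset.le_sup (f := g) (Finset.mem_erase.2 ⟨hne.symm, h.1⟩)))

theorem mdeg_insert (i : κ) (s : Finset κ) : mdeg g (insert i s) = g i ⊔ mdeg g s :=
  Finset.sup_insert

/-- The faces with multidegree below `b` form a cone with apex `x`. Toggling the chosen vertex keeps
the multidegree, hence stays below `b`, and pairs a non-Scarf face with another face of equal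
multidegree, which is therefore non-Scarf too. -/
theorem scarfAcyclicAt_of_two_nondominant {n₁ n₂ : κ}
    (hdom : ∀ i, i ≠ n₁ → i ≠ n₂ → ∃ x, 0 < g i x ∧ ∀ j, j ≠ i → g j x < g i x)
    (hexp : ∀ x, g n₁ x ≠ 0 → g n₁ x ≠ g n₂ x) (K : Type*) [Field K]
    (x : κ) (b : ι →₀ ℕ) (hx : g x ≤ b) : ScarfAcyclicAt g K b := by
  choose v hvT hv using exists_toggle hdom hexp
  intro z hz hz0
  refine exists_simplexBoundary_eq_of_matching (T := {n₁, n₂}) (v := v) ?_ ?_ hvT ?_ ?_ x ?_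
    hz hz0
  · exact fun s hs i _ => (mdeg_mono g (Finset.erase_subset i s)).trans hs
  · exact fun s hs i hi => erase_mem_scarfFaces g hs hi
  · intro s hs hsc
    rw [Set.mem_ofPred_eq, mdeg_insert]
    exact sup_le (((hv _ s rfl hsc).trans (mdeg_mono g (Finset.erase_subset _ s))).trans hs) hs
  · intro s hsc herase
    have h := hv _ s rfl hsc
    set y := v (outerPart {n₁, n₂} s)
    have hins : mdeg g (insert y (s.erase y)) = mdeg g (s.erase y) := by
      rw [mdeg_insert]; exact sup_eq_right.2 h
    have := herase _ hins
    exact Finset.notMem_erase y s (Finset.insert_eq_self.1 this)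
  · intro s hs
    rw [Set.mem_ofPred_eq, mdeg_insert]
    exact sup_le hx hs

end Semidominant

/-! ### Minimal generators of a monomial ideal. -/

section MinimalGenerators

variable {ι : Type*} {K : Type*} [Field K] {M : Ideal (MvPolynomial ι K)}

theorem exists_minGens_le [Finite ι] {b : ι →₀ ℕ} (hb : monomial b (1 : K) ∈ M) :
    ∃ a ∈ minGens M, a ≤ b := by
  obtain ⟨a, hab, ha⟩ := exists_minimal_le_of_wellFoundedLT
    (fun b => monomial b (1 : K) ∈ M) b hb
  exact ⟨a, ha, hab⟩

theorem IsMonomialIdeal.monomial_mem (hM : IsMonomialIdeal M) {p : MvPolynomial ι K} (hp : p ∈ M)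
    {b : ι →₀ ℕ} (hb : coeff b p ≠ 0) : monomial b (1 : K) ∈ M := by
  obtain ⟨A, rfl⟩ := hM
  obtain ⟨a, ha, hab⟩ := mem_ideal_span_monomial_image.1 hp b (mem_support_iff.2 hb)
  rw [mem_ideal_span_monomial_image]
  intro c hc
  rw [Finset.mem_singleton.1 (support_monomial_subset hc)]
  exact ⟨a, ha, hab⟩

theorem eq_of_zero_mem_minGens (h0 : (0 : ι →₀ ℕ) ∈ minGens M) {a : ι →₀ ℕ}
    (ha : a ∈ minGens M) : a = 0 :=
  le_antisymm (ha.2 h0.1 (zero_le)) (zero_le)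

end MinimalGenerators

end MonomialIdeal

theorem corollary6p9 {ι : Type*} [Finite ι] {K : Type*} [Field K]
    (M : Ideal (MvPolynomial ι K)) (hM : MonomialIdeal.IsSemidominant 2 M)
    (n₁ n₂ : ι →₀ ℕ)
    (hn : MonomialIdeal.nondominant (MonomialIdeal.minGens M) = {n₁, n₂})
    (hexp : ∀ x : ι, n₁ x ≠ 0 → n₁ x ≠ n₂ x) :
    MonomialIdeal.IsScarf M := by
  intro _
  have hne : n₁ ≠ n₂ := by
    rintro rfl
    have := hM.2
    rw [hn, Set.pair_eq_singleton, Set.encard_singleton] at this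
    norm_num at this
  have h1 : n₁ ∈ MonomialIdeal.nondominant (MonomialIdeal.minGens M) := by simp [hn]
  have h2 : n₂ ∈ MonomialIdeal.nondominant (MonomialIdeal.minGens M) := by simp [hn]
  refine MonomialIdeal.isMinimalScarfResolution_of_acyclic (fun x => x.2.1) ?_ ?_ ?_
  · intro p hp b hb
    obtain ⟨a, ha, hab⟩ := MonomialIdeal.exists_minGens_le (hM.1.monomial_mem hp hb)
    exact ⟨⟨a, ha⟩, hab⟩
  · rintro ⟨a, ha⟩ h
    obtain rfl : a = 0 := h
    -- If `1` were a minimal generator it would be the only one, but `n₁` and `n₂` are distinct.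
    exact hne ((MonomialIdeal.eq_of_zero_mem_minGens ha h1.1).trans
      (MonomialIdeal.eq_of_zero_mem_minGens ha h2.1).symm)
  · refine MonomialIdeal.scarfAcyclicAt_of_two_nondominant (n₁ := ⟨n₁, h1.1⟩)
      (n₂ := ⟨n₂, h2.1⟩) ?_ hexp K
    rintro ⟨a, ha⟩ ha1 ha2
    have hdom : MonomialIdeal.IsDominant (MonomialIdeal.minGens M) a := by
      by_contra h
      have : a ∈ MonomialIdeal.nondominant (MonomialIdeal.minGens M) := ⟨ha, h⟩
      rw [hn] at this
      rcases this with h | h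
      · exact ha1 (Subtype.ext h)
      · exact ha2 (Subtype.ext h)
    obtain ⟨-, x, k, hk, hkx, hx⟩ := hdom
    refine ⟨x, hk.trans_le hkx, ?_⟩
    rintro ⟨b, hb⟩ hba
    exact (not_le.1 (hx b hb fun h => hba (Subtype.ext h))).trans_le hkx
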